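/- Let $p\ge 0$ be an integer and let $\Omega\subset\mathbb{C}$ be a bounded domain (non-empty, open, connected) with $C^\infty$ smooth boundary; that is, every $x\in\partial\Omega$ has an open neighbourhood $U$ with a $C^\infty$ function $\rho:U\to\mathbb{R}$ such that $d\rho(x)\neq 0$ and $\Omega\cap U=\{z\in U:\rho(z)<0\}$. Let $\mathcal{A}^\infty(\Omega)$ denote the space of functions that are complex analytic on $\Omega$ and $C^\infty$ smooth up to the boundary, i.e. on $\overline{\Omega}$. Suppose that $\Omega$ is a one-point quadrature domain with respect to the weighted area measure $|z|^{2p}\,dA$ whose node is the origin: $0\in\Omega$ and there is a constant $c\in\mathbb{C}$ such that $$\int_\Omega f(z)\,|z|^{2p}\,dA(z)=c\,f(0)\qquad\text{for all } f\in\mathcal{A}^\infty(\Omega),$$ where $dA$ is Lebesgue area measure. Then $\Omega$ is an open disc centered at the origin: $\Omega=\{z\in\mathbb{C}:|z|<r\}$ for some $r>0$. -/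

import Mathlib

open MeasureTheory
open scoped ContDiff

/-- `Ω` is a bounded domain (non-empty connected open set) in the plane with `C^∞` smooth boundary:
near each boundary point, `Ω` is the strict sublevel set of a smooth real function whose
differential does not vanish at that point. -/
structure IsSmoothBoundedDomain (Ω : Set ℂ) : Prop where
  isOpen : IsOpen Ω
  isConnected : IsConnected Ω
  isBounded : Bornology.IsBounded Ω
  smooth_frontier : ∀ x ∈ frontier Ω, ∃ (U : Set ℂ) (ρ : ℂ → ℝ), IsOpen U ∧ x ∈ U ∧
    ContDiffOn ℝ ∞ ρ U ∧ fderiv ℝ ρ x ≠ 0 ∧ Ω ∩ U = {z ∈ U | ρ z < 0}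

/-- The class `𝒜^∞(Ω)`: functions that are complex analytic on `Ω` and `C^∞` smooth (in the real
sense) up to the boundary. -/
def smoothAnalyticFunctions (Ω : Set ℂ) : Set (ℂ → ℂ) :=
  {f | DifferentiableOn ℂ f Ω ∧ ContDiffOn ℝ ∞ f (closure Ω)}

/-- `Ω` is a one-point quadrature domain with node `z₀ ∈ Ω` for the weighted area measure `w dA`,
with test class `𝒜^∞(Ω)`: integration against `w dA` over `Ω` is a constant multiple of
evaluation at `z₀`. -/
def IsOnePointQuadratureDomain (w : ℂ → ℝ) (Ω : Set ℂ) (z₀ : ℂ) : Prop :=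
  z₀ ∈ Ω ∧ ∃ c : ℂ, ∀ f ∈ smoothAnalyticFunctions Ω,
    ∫ z in Ω, f z * (w z : ℂ) = c * f z₀

/-! This is Kuran's argument. Let `x` be a boundary point nearest to 0 and `B` the centered disc
through it. The function `h z = 2 * z / (z - x)` vanishes at 0 and has real part at least 1 off `B`.
If `h` were admissible, its weighted integral would vanish over `Ω` by the quadrature identity and
over `B` by the mean value property, hence over `Ω \ B`. Positivity then makes `Ω \ B` null.

The pole of `h` lies on the boundary, so it is first moved to a point `a` outside the closure.
Smoothness lets `a` tend to `x` (`mem_closure_compl_closure`), and both integrals follow by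
continuity of the Cauchy transform (`continuous_setIntegral_mul_inv_sub`). -/

/-! ### Continuity of Cauchy transforms -/

/-- The singularity `‖z - a‖ ^ (-3/2)` is integrable on discs in the plane, with a bound that is
uniform in `a` for `a` in a disc. -/
theorem exists_setIntegral_norm_sub_rpow_le {S : Set ℂ} {R : ℝ}
    (hS : S ⊆ Metric.ball 0 R) :
    ∃ C : ℝ, ∀ a ∈ Metric.ball (0 : ℂ) R,
      IntegrableOn (fun z : ℂ => ‖z - a‖ ^ (-(3 / 2) : ℝ)) S ∧
      ∫ z in S, ‖z - a‖ ^ (-(3 / 2) : ℝ) ≤ C := by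
  -- The radius `2 * R` covers every difference of two points of the disc, so one integral bounds
  -- all poles at once.
  set k : ℂ → ℝ := (Metric.ball (0 : ℂ) (2 * R)).indicator fun u => ‖u‖ ^ (-(3 / 2) : ℝ) with hk
  have hkint : Integrable k := by
    have hrad : k = fun u : ℂ =>
        (Set.Iio (2 * R)).indicator (fun y : ℝ => y ^ (-(3 / 2) : ℝ)) ‖u‖ := by
      ext u
      by_cases h : ‖u‖ < 2 * R <;> simp [hk, h]
    rw [hrad, integrable_fun_norm_addHaar volume
      (f := (Set.Iio (2 * R)).indicator (fun y : ℝ => y ^ (-(3 / 2) : ℝ)))]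
    -- The polar Jacobian raises the exponent from -3/2 to -1/2, which is integrable at 0.
    have hsub : IntegrableOn (fun y : ℝ => y ^ (-(1 / 2) : ℝ)) (Set.Ioo 0 (2 * R)) := by
      rcases le_total (2 * R) 0 with h | h
      · simp [Set.Ioo_eq_empty_of_le h]
      · exact ((intervalIntegrable_iff_integrableOn_Ioo_of_le h).1
          (intervalIntegral.intervalIntegrable_rpow' (by norm_num)))
    have hind := hsub.integrable_indicator measurableSet_Ioo
    refine (hind.integrableOn (s := Set.Ioi 0)).congr_fun (fun y hy => ?_) measurableSet_Ioi
    have hy : 0 < y := hy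
    by_cases h : y < 2 * R
    · simp only [Complex.finrank_real_complex, Set.indicator_apply, Set.mem_Ioo, Set.mem_Iio, hy, h,
        and_self, if_true, smul_eq_mul]
      rw [← Real.rpow_natCast, ← Real.rpow_add hy]
      norm_num
    · simp [h]
  refine ⟨∫ u, k u, fun a ha => ?_⟩
  have hka : Integrable fun z => k (z - a) := hkint.comp_sub_right a
  have heq : Set.EqOn (fun z => k (z - a)) (fun z => ‖z - a‖ ^ (-(3 / 2) : ℝ))
      (Metric.ball 0 R) := by
    intro z hz
    have : z - a ∈ Metric.ball (0 : ℂ) (2 * R) := by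
      simp only [mem_ball_zero_iff] at *
      linarith [norm_sub_le z a]
    simp [hk, this]
  have hball : IntegrableOn (fun z : ℂ => ‖z - a‖ ^ (-(3 / 2) : ℝ)) (Metric.ball 0 R) :=
    hka.integrableOn.congr_fun heq measurableSet_ball
  refine ⟨hball.mono_set hS, ?_⟩
  calc ∫ z in S, ‖z - a‖ ^ (-(3 / 2) : ℝ)
      ≤ ∫ z in Metric.ball 0 R, ‖z - a‖ ^ (-(3 / 2) : ℝ) :=
        setIntegral_mono_set hball (ae_of_all _ fun z => by positivity)
          (Filter.Eventually.of_forall hS)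
    _ = ∫ z in Metric.ball 0 R, k (z - a) :=
        (setIntegral_congr_fun measurableSet_ball heq).symm
    _ ≤ ∫ z, k (z - a) := setIntegral_le_integral hka
        (ae_of_all _ fun z => Set.indicator_nonneg (fun _ _ => by positivity) _)
    _ = ∫ u, k u := integral_sub_right_eq_self k a

/-- Replacing the larger of `s`, `t` by the smaller increases the product to a pure power. This
separates two singularities. -/
theorem inv_mul_rpow_neg_half_le {s t : ℝ} (hs : 0 < s) (ht : 0 < t) :
    s⁻¹ * t ^ (-(1 / 2) : ℝ) ≤ s ^ (-(3 / 2) : ℝ) + t ^ (-(3 / 2) : ℝ) := by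
  rcases le_total s t with h | h
  · have h1 : t ^ (-(1 / 2) : ℝ) ≤ s ^ (-(1 / 2) : ℝ) :=
      Real.rpow_le_rpow_of_nonpos hs h (by norm_num)
    have h2 : s⁻¹ * s ^ (-(1 / 2) : ℝ) = s ^ (-(3 / 2) : ℝ) := by
      rw [← Real.rpow_neg_one, ← Real.rpow_add hs]; norm_num
    have h3 : 0 ≤ t ^ (-(3 / 2) : ℝ) := by positivity
    have := mul_le_mul_of_nonneg_left h1 (inv_pos.2 hs).le
    linarith
  · have h1 : s⁻¹ ≤ t⁻¹ := inv_anti₀ ht h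
    have h2 : t⁻¹ * t ^ (-(1 / 2) : ℝ) = t ^ (-(3 / 2) : ℝ) := by
      rw [← Real.rpow_neg_one, ← Real.rpow_add ht]; norm_num
    have h3 : 0 ≤ s ^ (-(3 / 2) : ℝ) := by positivity
    have := mul_le_mul_of_nonneg_right h1 (show 0 ≤ t ^ (-(1 / 2) : ℝ) by positivity)
    linarith

/-- A Hölder estimate for the Cauchy kernel as a function of its pole. -/
theorem norm_inv_sub_sub_inv_sub_le {z a b : ℂ} (ha : z ≠ a) (hb : z ≠ b) :
    ‖(z - a)⁻¹ - (z - b)⁻¹‖ ≤ 2 * ‖a - b‖ ^ (1 / 2 : ℝ) *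
      (‖z - a‖ ^ (-(3 / 2) : ℝ) + ‖z - b‖ ^ (-(3 / 2) : ℝ)) := by
  have ha' : z - a ≠ 0 := sub_ne_zero.2 ha
  have hb' : z - b ≠ 0 := sub_ne_zero.2 hb
  have hs : 0 < ‖z - a‖ := norm_pos_iff.2 ha'
  have ht : 0 < ‖z - b‖ := norm_pos_iff.2 hb'
  set s := ‖z - a‖
  set t := ‖z - b‖
  set d := ‖a - b‖ with hd
  have hd0 : 0 ≤ d := norm_nonneg _
  have hkey : ‖(z - a)⁻¹ - (z - b)⁻¹‖ = d * (s⁻¹ * t⁻¹) := by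
    have : (z - a)⁻¹ - (z - b)⁻¹ = (a - b) * ((z - a)⁻¹ * (z - b)⁻¹) := by
      field_simp; ring
    rw [this, norm_mul, norm_mul, norm_inv, norm_inv]
  have hdst : d ≤ s + t := by
    have : a - b = (z - b) - (z - a) := by ring
    rw [hd, this]
    linarith [norm_sub_le (z - b) (z - a)]
  -- One factor `d ^ (1/2)` is the Hölder gain; the other is spent, by subadditivity of the square
  -- root, on lowering the total order of the singularity from 2 to the integrable 3/2.
  have hsplit : d = d ^ (1 / 2 : ℝ) * d ^ (1 / 2 : ℝ) := by
    rw [← Real.mul_rpow hd0 hd0, ← pow_two, ← Real.sqrt_eq_rpow, Real.sqrt_sq hd0]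
  have hhalf : d ^ (1 / 2 : ℝ) ≤ s ^ (1 / 2 : ℝ) + t ^ (1 / 2 : ℝ) :=
    (Real.rpow_le_rpow hd0 hdst (by norm_num)).trans
      (Real.rpow_add_le_add_rpow hs.le ht.le (by norm_num) (by norm_num))
  have e1 : ∀ {x : ℝ}, 0 < x → x ^ (1 / 2 : ℝ) * x⁻¹ = x ^ (-(1 / 2) : ℝ) := fun hx => by
    rw [← Real.rpow_neg_one, ← Real.rpow_add hx]; norm_num
  have h1 := inv_mul_rpow_neg_half_le hs ht
  have h2 := inv_mul_rpow_neg_half_le ht hs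
  rw [hkey]
  calc d * (s⁻¹ * t⁻¹) = d ^ (1 / 2 : ℝ) * (d ^ (1 / 2 : ℝ) * (s⁻¹ * t⁻¹)) := by
        conv_lhs => rw [hsplit]
        ring
    _ ≤ d ^ (1 / 2 : ℝ) * ((s ^ (1 / 2 : ℝ) + t ^ (1 / 2 : ℝ)) * (s⁻¹ * t⁻¹)) := by
        gcongr
    _ = d ^ (1 / 2 : ℝ) * (t⁻¹ * (s ^ (1 / 2 : ℝ) * s⁻¹) + s⁻¹ * (t ^ (1 / 2 : ℝ) * t⁻¹)) := by
        ring
    _ = d ^ (1 / 2 : ℝ) * (t⁻¹ * s ^ (-(1 / 2) : ℝ) + s⁻¹ * t ^ (-(1 / 2) : ℝ)) := by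
        rw [e1 hs, e1 ht]
    _ ≤ d ^ (1 / 2 : ℝ) * (2 * (s ^ (-(3 / 2) : ℝ) + t ^ (-(3 / 2) : ℝ))) := by
        gcongr
        linarith
    _ = _ := by ring

theorem integrableOn_mul_inv_sub {S : Set ℂ} (hS : Bornology.IsBounded S) (hSm : MeasurableSet S)
    {g : ℂ → ℂ} (hg : Continuous g) (a : ℂ) :
    IntegrableOn (fun z => g z * (z - a)⁻¹) S := by
  obtain ⟨R₀, hR₀⟩ := hS.subset_closedBall 0
  set R := max R₀ ‖a‖ + 1 with hR
  have hSR : S ⊆ Metric.ball 0 R := hR₀.trans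
    (Metric.closedBall_subset_ball (by linarith [le_max_left R₀ ‖a‖]))
  have haR : a ∈ Metric.ball (0 : ℂ) R := by
    rw [mem_ball_zero_iff]; linarith [le_max_right R₀ ‖a‖]
  obtain ⟨C, hC⟩ := exists_setIntegral_norm_sub_rpow_le hSR
  obtain ⟨M, hM⟩ := (isCompact_closedBall (0 : ℂ) R).exists_bound_of_continuousOn hg.continuousOn
  have hR0 : 0 < R := by linarith [le_max_right R₀ ‖a‖, norm_nonneg a]
  have hM0 : 0 ≤ M := (norm_nonneg _).trans (hM 0 (by simp [hR0.le]))
  have hk := (hC a haR).1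
  have hfin : volume S ≠ ⊤ := ((measure_mono hSR).trans_lt measure_ball_lt_top).ne
  have hbound : IntegrableOn (fun z : ℂ => M * (1 + ‖z - a‖ ^ (-(3 / 2) : ℝ))) S :=
    ((integrableOn_const hfin).add hk).const_mul M
  refine Integrable.mono' hbound (by
    have : Measurable fun z => g z * (z - a)⁻¹ :=
      hg.measurable.mul (measurable_id.sub_const a).inv
    exact this.aestronglyMeasurable) ?_
  filter_upwards [ae_restrict_mem hSm] with z hz
  rw [norm_mul, norm_inv]
  have h1 : ‖g z‖ ≤ M := hM z (Metric.ball_subset_closedBall (hSR hz))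
  have h2 : ‖z - a‖⁻¹ ≤ 1 + ‖z - a‖ ^ (-(3 / 2) : ℝ) := by
    have h0 : 0 ≤ ‖z - a‖ ^ (-(3 / 2) : ℝ) := by positivity
    rcases (norm_nonneg (z - a)).eq_or_lt with h | h
    · rw [← h] at h0 ⊢
      rw [inv_zero]
      linarith
    · have := inv_mul_rpow_neg_half_le h one_pos
      simp only [Real.one_rpow, mul_one] at this
      linarith
  gcongr

/-- The Cauchy transform of a bounded density on a bounded set is continuous in the whole plane. -/
theorem continuous_setIntegral_mul_inv_sub {S : Set ℂ} (hS : Bornology.IsBounded S)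
    (hSm : MeasurableSet S) {g : ℂ → ℂ} (hg : Continuous g) :
    Continuous fun a => ∫ z in S, g z * (z - a)⁻¹ := by
  rw [continuous_iff_continuousAt]
  intro b
  obtain ⟨R₀, hR₀⟩ := hS.subset_closedBall 0
  set R := max R₀ ‖b‖ + 1 with hR
  have hSR : S ⊆ Metric.ball 0 R := hR₀.trans
    (Metric.closedBall_subset_ball (by linarith [le_max_left R₀ ‖b‖]))
  have hbR : b ∈ Metric.ball (0 : ℂ) R := by
    rw [mem_ball_zero_iff]; linarith [le_max_right R₀ ‖b‖]
  obtain ⟨C, hC⟩ := exists_setIntegral_norm_sub_rpow_le hSR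
  obtain ⟨M, hM⟩ := (isCompact_closedBall (0 : ℂ) R).exists_bound_of_continuousOn hg.continuousOn
  have hR0 : 0 < R := by linarith [le_max_right R₀ ‖b‖, norm_nonneg b]
  have hM0 : 0 ≤ M := (norm_nonneg _).trans (hM 0 (by simp [hR0.le]))
  rw [ContinuousAt, tendsto_iff_norm_sub_tendsto_zero]
  have hlim : Filter.Tendsto (fun a : ℂ => M * (2 * ‖a - b‖ ^ (1 / 2 : ℝ)) * (C + C))
      (nhds b) (nhds 0) := by
    have : Continuous fun a : ℂ => M * (2 * ‖a - b‖ ^ (1 / 2 : ℝ)) * (C + C) := by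
      have h : Continuous fun a : ℂ => ‖a - b‖ ^ (1 / 2 : ℝ) :=
        (by fun_prop : Continuous fun a : ℂ => ‖a - b‖).rpow_const fun _ => Or.inr (by norm_num)
      fun_prop
    convert this.tendsto b using 2
    rw [sub_self, norm_zero, Real.zero_rpow (by norm_num)]
    ring
  refine squeeze_zero' (Filter.Eventually.of_forall fun a => norm_nonneg _) ?_ hlim
  filter_upwards [Metric.isOpen_ball.mem_nhds hbR] with a haR
  rw [← integral_sub (integrableOn_mul_inv_sub hS hSm hg a) (integrableOn_mul_inv_sub hS hSm hg b)]
  obtain ⟨hia, hCa⟩ := hC a haR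
  obtain ⟨hib, hCb⟩ := hC b hbR
  calc ‖∫ z in S, (g z * (z - a)⁻¹ - g z * (z - b)⁻¹)‖
      ≤ ∫ z in S, M * (2 * ‖a - b‖ ^ (1 / 2 : ℝ)) *
          (‖z - a‖ ^ (-(3 / 2) : ℝ) + ‖z - b‖ ^ (-(3 / 2) : ℝ)) := by
        refine norm_integral_le_of_norm_le ((hia.add hib).const_mul _) ?_
        filter_upwards [ae_restrict_mem hSm, ae_restrict_of_ae (Measure.ae_ne volume a),
          ae_restrict_of_ae (Measure.ae_ne volume b)] with z hz hza hzb
        rw [← mul_sub, norm_mul, mul_assoc]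
        exact mul_le_mul (hM z (Metric.ball_subset_closedBall (hSR hz)))
          (norm_inv_sub_sub_inv_sub_le hza hzb) (norm_nonneg _) hM0
    _ = M * (2 * ‖a - b‖ ^ (1 / 2 : ℝ)) * ((∫ z in S, ‖z - a‖ ^ (-(3 / 2) : ℝ)) +
          ∫ z in S, ‖z - b‖ ^ (-(3 / 2) : ℝ)) := by
        rw [integral_const_mul, integral_add hia hib]
    _ ≤ _ := by gcongr

/-! ### Mean value property on discs -/

/-- The mean value property for the radial weight `‖z‖ ^ n` on a disc, for analytic functions
vanishing at the center. -/
theorem setIntegral_ball_mul_norm_pow_eq_zero {r : ℝ} {f : ℂ → ℂ} (n : ℕ)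
    (hf : ∀ z ∈ Metric.closedBall (0 : ℂ) r, DifferentiableAt ℂ f z) (hf0 : f 0 = 0) :
    ∫ z in Metric.ball (0 : ℂ) r, f z * ((‖z‖ ^ n : ℝ) : ℂ) = 0 := by
  rw [← integral_indicator measurableSet_ball, ← Complex.integral_comp_polarCoord_symm]
  set G : ℝ × ℝ → ℂ := fun q => ((q.1 ^ (n + 1) : ℝ) : ℂ) * f (circleMap 0 q.1 q.2) with hG
  have hpt : Set.EqOn (fun q : ℝ × ℝ => q.1 • (Metric.ball (0 : ℂ) r).indicator
      (fun z => f z * ((‖z‖ ^ n : ℝ) : ℂ)) (Complex.polarCoord.symm q))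
      ((Set.Iio r ×ˢ (Set.univ : Set ℝ)).indicator G) polarCoord.target := by
    rintro ⟨s, θ⟩ hq
    have hs : 0 < s := hq.1
    have hsymm : Complex.polarCoord.symm (s, θ) = circleMap 0 s θ := by
      rw [Complex.polarCoord_symm_apply, circleMap_zero, Complex.exp_mul_I]
      push_cast
      rfl
    have hnorm : ‖circleMap 0 s θ‖ = s := by simp [abs_of_pos hs]
    simp only [hsymm]
    by_cases h : s < r
    · rw [Set.indicator_of_mem (by simpa [hnorm] using h), Set.indicator_of_mem (by simpa using h)]
      simp only [hG, hnorm, Complex.real_smul]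
      push_cast
      ring
    · rw [Set.indicator_of_notMem (by simpa [abs_of_pos hs] using h),
        Set.indicator_of_notMem (by simpa using h), smul_zero]
  rw [setIntegral_congr_fun polarCoord.open_target.measurableSet hpt,
    setIntegral_indicator (measurableSet_Iio.prod MeasurableSet.univ)]
  have hset : polarCoord.target ∩ Set.Iio r ×ˢ (Set.univ : Set ℝ) =
      Set.Ioo 0 r ×ˢ Set.Ioo (-Real.pi) Real.pi := by
    ext ⟨s, θ⟩
    simp [polarCoord, and_assoc, and_comm, and_left_comm]
  have hcont : ContinuousOn G (Set.Icc 0 r ×ˢ Set.Icc (-Real.pi) Real.pi) := by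
    refine ContinuousOn.mul (by fun_prop) ?_
    have hcm : Continuous fun q : ℝ × ℝ => circleMap 0 q.1 q.2 := by
      unfold circleMap
      fun_prop
    refine ContinuousOn.comp (t := Metric.closedBall (0 : ℂ) r)
      (fun z hz => (hf z hz).continuousAt.continuousWithinAt) hcm.continuousOn ?_
    rintro ⟨s, θ⟩ hq
    have hs := hq.1
    simp only [Set.mem_Icc] at hs
    simp [abs_of_nonneg hs.1, hs.2]
  have hint : IntegrableOn G (Set.Ioo 0 r ×ˢ Set.Ioo (-Real.pi) Real.pi) :=
    (hcont.integrableOn_compact (isCompact_Icc.prod isCompact_Icc)).mono_set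
      (Set.prod_mono Set.Ioo_subset_Icc_self Set.Ioo_subset_Icc_self)
  rw [hset, Measure.volume_eq_prod, setIntegral_prod _ hint]
  refine setIntegral_eq_zero_of_forall_eq_zero fun s hs => ?_
  simp only [hG]
  rw [integral_const_mul]
  have hmean : Real.circleAverage f 0 s = f 0 := by
    refine circleAverage_of_differentiable_on_off_countable Set.countable_empty ?_ ?_
    · intro z hz
      rw [abs_of_pos hs.1] at hz
      exact (hf z (Metric.closedBall_subset_closedBall hs.2.le hz)).continuousAt.continuousWithinAt
    · intro z hz
      rw [abs_of_pos hs.1] at hz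
      exact hf z (Metric.closedBall_subset_closedBall hs.2.le (Metric.ball_subset_closedBall hz.1))
  have hper : Function.Periodic (fun θ => f (circleMap 0 s θ)) (2 * Real.pi) := fun θ => by
    simp only [periodic_circleMap 0 s θ]
  have hzero : ∫ θ in (0 : ℝ)..2 * Real.pi, f (circleMap 0 s θ) = 0 := by
    rw [Real.circleAverage_def, hf0, smul_eq_zero] at hmean
    exact hmean.resolve_left (by positivity)
  -- Polar angles run over `(-π, π)`, circle averages over `[0, 2π]`.
  have hshift := hper.intervalIntegral_add_eq (-Real.pi) 0
  rw [zero_add, hzero, show -Real.pi + 2 * Real.pi = Real.pi by ring,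
    intervalIntegral.integral_of_le (by linarith [Real.pi_pos]), integral_Ioc_eq_integral_Ioo]
    at hshift
  rw [hshift, mul_zero]

/-! ### Boundary geometry -/

namespace IsSmoothBoundedDomain

variable {Ω : Set ℂ}

/-- A domain with smooth boundary lies locally on one side of its boundary. -/
theorem mem_closure_compl_closure (hΩ : IsSmoothBoundedDomain Ω) {x : ℂ}
    (hx : x ∈ frontier Ω) : x ∈ closure (closure Ω)ᶜ := by
  obtain ⟨U, ρ, hU, hxU, hρ, hdρ, hΩU⟩ := hΩ.smooth_frontier x hx
  by_contra hcon
  rw [closure_compl, Set.mem_compl_iff, not_not, mem_interior_iff_mem_nhds] at hcon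
  -- If `x` were interior to the closure, `ρ` would have a local maximum there, since a point with
  -- `ρ > 0` has a neighbourhood missing `Ω`.
  have hle : ∀ᶠ z in nhds x, ρ z ≤ 0 := by
    filter_upwards [hcon, hU.mem_nhds hxU] with z hz hzU
    by_contra! hpos
    have hev : ∀ᶠ y in nhds z, 0 < ρ y ∧ y ∈ U :=
      ((hρ.continuousOn.continuousAt (hU.mem_nhds hzU)).eventually (lt_mem_nhds hpos)).and
        (hU.mem_nhds hzU)
    obtain ⟨y, hyΩ, hy⟩ := (mem_closure_iff_frequently.1 hz).and_eventually hev |>.exists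
    have : y ∈ {z ∈ U | ρ z < 0} := hΩU ▸ ⟨hyΩ, hy.2⟩
    exact absurd this.2 hy.1.not_gt
  have hx0 : 0 ≤ ρ x := by
    by_contra! hneg
    have : x ∈ Ω ∩ U := hΩU ▸ ⟨hxU, hneg⟩
    rw [hΩ.isOpen.frontier_eq] at hx
    exact hx.2 this.1
  exact hdρ (IsLocalMax.fderiv_eq_zero (hle.mono fun z hz => hz.trans hx0))

/-- The largest centered disc inside a bounded domain touches the boundary. -/
theorem exists_ball_subset (hΩ : IsSmoothBoundedDomain Ω) (h0 : (0 : ℂ) ∈ Ω) :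
    ∃ x ∈ frontier Ω, 0 < ‖x‖ ∧ Metric.ball (0 : ℂ) ‖x‖ ⊆ Ω := by
  have hne : (Ωᶜ).Nonempty := by
    rw [Set.nonempty_compl]
    rintro rfl
    exact NormedSpace.unbounded_univ ℂ ℂ hΩ.isBounded
  obtain ⟨x, hx, hdist⟩ := hΩ.isOpen.isClosed_compl.exists_infDist_eq_dist hne 0
  rw [dist_zero_left] at hdist
  have hball : Metric.ball (0 : ℂ) ‖x‖ ⊆ Ω := by
    rw [← hdist]
    exact Metric.ball_infDist_compl_subset
  have hx0 : x ≠ 0 := fun h => hx (h ▸ h0)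
  refine ⟨x, ?_, norm_pos_iff.2 hx0, hball⟩
  rw [hΩ.isOpen.frontier_eq]
  refine ⟨closure_mono hball ?_, hx⟩
  rw [closure_ball _ (norm_ne_zero_iff.2 hx0)]
  simp

end IsSmoothBoundedDomain

/-! ### Kuran's argument -/

/-- Outside the disc through its pole, Kuran's function is at least `1`. -/
theorem one_le_re_two_mul_mul_inv_sub {z x : ℂ} (hzx : z ≠ x) (h : ‖x‖ ≤ ‖z‖) :
    1 ≤ (2 * z * (z - x)⁻¹).re := by
  have hne : 0 < Complex.normSq (z - x) := Complex.normSq_pos.2 (sub_ne_zero.2 hzx)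
  have hsq : Complex.normSq x ≤ Complex.normSq z := by
    rw [Complex.normSq_eq_norm_sq, Complex.normSq_eq_norm_sq]
    gcongr
  have hre : (2 * z * (z - x)⁻¹).re =
      (2 * z.re * (z - x).re + 2 * z.im * (z - x).im) / Complex.normSq (z - x) := by
    simp [Complex.mul_re, Complex.inv_re, Complex.inv_im]
    ring
  -- The real part equals `1 + (‖z‖² - ‖x‖²) / ‖z - x‖²`.
  rw [hre, le_div_iff₀ hne]
  simp only [Complex.normSq_apply, Complex.sub_re, Complex.sub_im] at hsq ⊢
  nlinarith

theorem mem_smoothAnalyticFunctions_mul_inv_sub {Ω : Set ℂ} {a : ℂ} (ha : a ∉ closure Ω) :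
    (fun z => 2 * z * (z - a)⁻¹) ∈ smoothAnalyticFunctions Ω := by
  have hne : ∀ z ∈ closure Ω, z - a ≠ 0 := fun z hz h => ha (sub_eq_zero.1 h ▸ hz)
  constructor
  · exact (differentiableOn_id.const_mul 2).mul
      ((differentiableOn_id.sub_const a).inv fun z hz => hne z (subset_closure hz))
  · exact (contDiffOn_const.mul contDiffOn_id).mul ((contDiffOn_id.sub contDiffOn_const).inv hne)

theorem mainTheorem10 (p : ℕ) (Ω : Set ℂ) (hΩ : IsSmoothBoundedDomain Ω)
    (hquad : IsOnePointQuadratureDomain (fun z : ℂ => ‖z‖ ^ (2 * p)) Ω 0) :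
    ∃ r : ℝ, 0 < r ∧ Ω = Metric.ball (0 : ℂ) r := by
  obtain ⟨h0, c, hc⟩ := hquad
  obtain ⟨x, hx, hx0, hball⟩ := hΩ.exists_ball_subset h0
  refine ⟨‖x‖, hx0, ?_⟩
  set B := Metric.ball (0 : ℂ) ‖x‖ with hB
  set g : ℂ → ℂ := fun z => 2 * z * ((‖z‖ ^ (2 * p) : ℝ) : ℂ) with hg
  have hgc : Continuous g := by fun_prop
  have hrw : ∀ a z : ℂ, g z * (z - a)⁻¹ = 2 * z * (z - a)⁻¹ * ((‖z‖ ^ (2 * p) : ℝ) : ℂ) :=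
    fun a z => by simp only [hg]; ring
  have hΩm := hΩ.isOpen.measurableSet
  have hΩ0 : ∀ a ∈ (closure Ω)ᶜ, ∫ z in Ω, g z * (z - a)⁻¹ = 0 := fun a ha => by
    simp_rw [hrw]
    rw [hc _ (mem_smoothAnalyticFunctions_mul_inv_sub ha)]
    simp
  have hB0 : ∀ a ∈ (closure Ω)ᶜ, ∫ z in B, g z * (z - a)⁻¹ = 0 := fun a ha => by
    simp_rw [hrw]
    refine setIntegral_ball_mul_norm_pow_eq_zero (f := fun z => 2 * z * (z - a)⁻¹) (2 * p)
      (fun z hz => ?_) (by simp)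
    have hz' : z ∈ closure Ω := closure_mono hball (by rwa [closure_ball _ hx0.ne'])
    have hne : z - a ≠ 0 := fun h => ha (sub_eq_zero.1 h ▸ hz')
    exact (differentiableAt_id.const_mul 2).mul ((differentiableAt_id.sub_const a).inv hne)
  have hxc := hΩ.mem_closure_compl_closure hx
  have hΩx : ∫ z in Ω, g z * (z - x)⁻¹ = 0 :=
    closure_minimal hΩ0 (isClosed_eq
      (continuous_setIntegral_mul_inv_sub hΩ.isBounded hΩm hgc) continuous_const) hxc
  have hBx : ∫ z in B, g z * (z - x)⁻¹ = 0 :=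
    closure_minimal hB0 (isClosed_eq
      (continuous_setIntegral_mul_inv_sub Metric.isBounded_ball measurableSet_ball hgc)
      continuous_const) hxc
  have hint := integrableOn_mul_inv_sub hΩ.isBounded hΩm hgc x
  have hdiff : ∫ z in Ω \ B, g z * (z - x)⁻¹ = 0 := by
    rw [setIntegral_sdiff measurableSet_ball hint hball, hΩx, hBx, sub_zero]
  have hintd : IntegrableOn (fun z => g z * (z - x)⁻¹) (Ω \ B) := hint.mono_set Set.sdiff_subset
  have hre : ∫ z in Ω \ B, (g z * (z - x)⁻¹).re = 0 := by
    rw [← Complex.zero_re, ← hdiff]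
    exact integral_re hintd
  have hpos : ∀ᵐ z ∂volume.restrict (Ω \ B), 0 < (g z * (z - x)⁻¹).re := by
    filter_upwards [ae_restrict_mem (hΩm.diff measurableSet_ball)] with z hz
    have hzx : z ≠ x := fun h => by
      rw [hΩ.isOpen.frontier_eq] at hx
      exact hx.2 (h ▸ hz.1)
    have hn : ‖x‖ ≤ ‖z‖ := by simpa [hB] using hz.2
    rw [hrw, Complex.re_mul_ofReal]
    exact mul_pos (one_pos.trans_le (one_le_re_two_mul_mul_inv_sub hzx hn))
      (pow_pos (hx0.trans_le hn) _)
  have hnull : volume (Ω \ B) = 0 := by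
    have hz := (setIntegral_eq_zero_iff_of_nonneg_ae (hpos.mono fun z hz => hz.le) hintd.re).1 hre
    have hfalse : ∀ᵐ z ∂volume.restrict (Ω \ B), False := by
      filter_upwards [hz, hpos] with z h1 h2
      exact h2.ne' h1
    rwa [Filter.eventually_false_iff_eq_bot, ae_eq_bot, Measure.restrict_eq_zero] at hfalse
  -- Removing the closed disc instead leaves an open null set, which must be empty.
  have hempty : Ω \ Metric.closedBall (0 : ℂ) ‖x‖ = ∅ :=
    (hΩ.isOpen.sdiff Metric.isClosed_closedBall).eq_empty_of_measure_zero
      (measure_mono_null (Set.sdiff_subset_sdiff_right Metric.ball_subset_closedBall) hnull)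
  refine Set.Subset.antisymm ?_ hball
  rw [hB, ← interior_closedBall _ hx0.ne']
  exact interior_maximal (Set.sdiff_eq_empty.1 hempty) hΩ.isOpen
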